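/- All graphs are finite, undirected and simple. For a graph $G=(V,E)$, $N_G(u)$ denotes the neighborhood of $u$, and $\Delta$ denotes symmetric difference. The local complementation of $G$ on a vertex $u$ is $G\star u = G\,\Delta\,K_{N_G(u)}$ (symmetric difference of edge sets), where $K_A$ is the complete graph on $A$. Pivoting on an edge $uv$ gives $G\wedge uv = G\star u\star v\star u$. For an independent set $A$, $G\star^1 A$ is the graph obtained by applying a local complementation on every vertex of $A$ (in any order). An independent set $S$ is 2-incident in $G$ if for any distinct $u,v\in V\setminus S$ the number $|N_G(u)\cap N_G(v)\cap S|$ is even, and for any distinct $u,v,w\in V\setminus S$ the number $|N_G(u)\cap N_G(v)\cap N_G(w)\cap S|$ is even. For such an $S$, $G\star^2 S$ is the graph on $V$ in which distinct $u,v$ are adjacent if and only if exactly one of the following holds: $u$ and $v$ are adjacent in $G$; $|N_G(u)\cap N_G(v)\cap S|\equiv 2 \pmod 4$. Consider the following two properties of a pair $(G,S)$: (P4) $S$ is 2-incident in $G$; (P5) there is no set $A\subseteq S$ such that $G\star^2 S = G\star^1 A$. **Lemma.** Let $G=(V,E)$ be a graph bipartite with respect to a bipartition $S, V\setminus S$ of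 its vertices, such that $(G,S)$ satisfies (P4) and (P5). Let $a\in S$ and $b\in V\setminus S$ be adjacent in $G$. - If $b$ has odd degree in $G$, let $G' = G\wedge ab$ and $S' = S\,\Delta\,\{a,b\}$. - If $b$ has even degree in $G$, let $G' = (G\wedge ab) - b$ (the vertex $b$ is deleted) and $S' = S\setminus\{a\}$. Then, with $V'$ the vertex set of $G'$, the graph $G'$ is bipartite with respect to the bipartition $S', V'\setminus S'$, and $(G',S')$ satisfies (P4) and (P5). -/

import Mathlib

open scoped symmDiff

namespace SimpleGraph

variable {V : Type*}

/-- The complete graph on the vertices of `A` (the vertices outside `A` are isolated). -/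
def completeOn (A : Set V) : SimpleGraph V where
  Adj u v := u ≠ v ∧ u ∈ A ∧ v ∈ A
  symm := ⟨fun _ _ h => ⟨h.1.symm, h.2.2, h.2.1⟩⟩
  loopless := ⟨fun _ h => h.1 rfl⟩

/-- Local complementation on `u`: the symmetric difference of `G` with the complete graph on the
neighborhood of `u`. -/
def localComplement (G : SimpleGraph V) (u : V) : SimpleGraph V :=
  G ∆ completeOn (G.neighborSet u)

/-- Pivoting on the edge `uv`: three successive local complementations, on `u`, `v` and `u`. -/
def pivot (G : SimpleGraph V) (u v : V) : SimpleGraph V :=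
  ((G.localComplement u).localComplement v).localComplement u

/-- 1-local complementation over `A`: a local complementation on every vertex of `A`, one after
another. When `A` is independent the order is irrelevant, see `foldl_localComplement_eq`. -/
noncomputable def oneLocalComplement (G : SimpleGraph V) (A : Finset V) : SimpleGraph V :=
  A.toList.foldl localComplement G

/-- An independent set `S` is 2-incident if any two, and any three, distinct vertices outside `S`
have an even number of common neighbors in `S`. -/
structure IsTwoIncident (G : SimpleGraph V) (S : Set V) : Prop where
  isIndepSet : G.IsIndepSet S
  even_pair : ∀ u v : V, u ∉ S → v ∉ S → u ≠ v →
    Even (G.neighborSet u ∩ G.neighborSet v ∩ S).ncard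
  even_triple : ∀ u v w : V, u ∉ S → v ∉ S → w ∉ S → u ≠ v → u ≠ w → v ≠ w →
    Even (G.neighborSet u ∩ G.neighborSet v ∩ G.neighborSet w ∩ S).ncard

/-- 2-local complementation over `S` (used when `S` is independent and 2-incident): toggle the
pairs of distinct vertices whose number of common neighbors in `S` is 2 modulo 4. -/
def twoLocalComplement (G : SimpleGraph V) (S : Set V) : SimpleGraph V where
  Adj u v := u ≠ v ∧
    Xor (G.Adj u v) ((G.neighborSet u ∩ G.neighborSet v ∩ S).ncard % 4 = 2)
  symm := ⟨fun u v h => by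
    rwa [ne_comm, G.adj_comm, Set.inter_comm (G.neighborSet v)]⟩
  loopless := ⟨fun _ h => h.1 rfl⟩

/-- The 2-local complementation over `S` is not realized by any 1-local complementation over a
(finite) subset of `S`. -/
def TwoLocalNotOneLocal (G : SimpleGraph V) (S : Set V) : Prop :=
  ¬ ∃ A : Finset V, (A : Set V) ⊆ S ∧ G.twoLocalComplement S = G.oneLocalComplement A

theorem localComplement_adj (G : SimpleGraph V) (u x y : V) :
    (G.localComplement u).Adj x y ↔
      Xor (G.Adj x y) (x ≠ y ∧ G.Adj u x ∧ G.Adj u y) := by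
  simp only [localComplement, symmDiff_def, sup_adj, sdiff_adj, completeOn, mem_neighborSet, Xor]

/-- Local complementation on `u` does not change the neighborhood of a vertex not adjacent
to `u`. -/
theorem localComplement_adj_of_not_adj (G : SimpleGraph V) {u v : V} (h : ¬ G.Adj u v) (x : V) :
    (G.localComplement u).Adj v x ↔ G.Adj v x := by
  simp [localComplement_adj, h, Xor]

/-- Local complementations on non-adjacent vertices commute. -/
theorem localComplement_comm (G : SimpleGraph V) {u v : V} (h : ¬ G.Adj u v) :
    (G.localComplement u).localComplement v = (G.localComplement v).localComplement u := by
  have h' : ¬ G.Adj v u := fun k => h k.symm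
  ext x y
  simp only [localComplement_adj _ v x y, localComplement_adj _ u x y,
    localComplement_adj_of_not_adj G h, localComplement_adj_of_not_adj G h', Xor]
  tauto

/-- The 1-local complementation over an independent set does not depend on the order in which the
vertices are taken. -/
theorem foldl_localComplement_eq (G : SimpleGraph V) (A : Finset V)
    (hA : G.IsIndepSet (A : Set V)) (l : List V) (hl : l.Perm A.toList) :
    l.foldl localComplement G = G.oneLocalComplement A := by
  have key : ∀ l₁ l₂ : List V, l₁.Perm l₂ → ∀ G : SimpleGraph V,
      (∀ u ∈ l₁, ∀ v ∈ l₁, ¬ G.Adj u v) →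
      l₁.foldl localComplement G = l₂.foldl localComplement G := by
    intro l₁ l₂ hp
    induction hp with
    | nil => intros; rfl
    | cons x _ ih =>
      intro G hG
      refine ih _ fun u hu v hv => ?_
      rw [localComplement_adj_of_not_adj G (hG x (by simp) u (by simp [hu]))]
      exact hG u (by simp [hu]) v (by simp [hv])
    | swap x y l =>
      intro G hG
      simp only [List.foldl_cons]
      rw [localComplement_comm G (hG y (by simp) x (by simp))]
    | trans h₁ _ ih₁ ih₂ =>
      intro G hG
      rw [ih₁ G hG]
      exact ih₂ G fun u hu v hv => hG u (h₁.mem_iff.2 hu) v (h₁.mem_iff.2 hv)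
  refine key l A.toList hl G fun u hu v hv huv => ?_
  have hu' : u ∈ (A : Set V) := by simpa using hl.mem_iff.1 hu
  have hv' : v ∈ (A : Set V) := by simpa using hl.mem_iff.1 hv
  exact hA hu' hv' huv.ne huv

end SimpleGraph

/-!
The proof encodes both properties as statements about a binary code that pivoting does not change.

Let `G` be bipartite with respect to `S`, `Sᶜ`. The closed neighborhoods of the vertices outside
`S` (`codewords G S`) are the rows of a generator matrix, in systematic form on `Sᶜ`, of a binary
code on the vertex set.

* `G` is 2-incident over `S` if and only if some integer weight on the vertices, odd on `S`, is
  even on every intersection of three codewords (`isTwoIncident_iff_exists_weight`).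
* Given 2-incidence, a set `A ⊆ S` whose 1-local complementation realizes the 2-local
  complementation over `S` exists if and only if some weight, odd on `S`, is moreover divisible
  by 4 on every intersection of two codewords
  (`IsTwoIncident.not_twoLocalNotOneLocal_iff`); `A` is the set where the weight is 3 modulo 4.

In both cases the weight of a vertex outside `S` is what makes its own codeword balanced, so it
is not restricted by the pairs and triples of distinct codewords. Both divisibility conditions
extend from a family of sets to its closure under symmetric difference, because
`|(X ∆ Y) ∩ Z| = |X ∩ Z| + |Y ∩ Z| - 2 |X ∩ Y ∩ Z|` holds with weights
(`IsTripleEven.closure`, `IsPairDoublyEven.closure`).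

Pivoting on `ab` is a change of basis: it exchanges `a` and `b` in the systematic form, and the old
and new codewords generate each other (`IsBipartiteWith.pivot_codewords_subset`,
`IsBipartiteWith.codewords_subset_pivot`). Hence the same weights serve before and after, and only
the parity requirements differ. They concern `b` in one direction and `a` in the other, and both
are read off the codeword `{b} ∪ N(b)`, which has even weight. If `b` has odd degree, its weight is
odd, as needed for `b` to enter `S'`. If `b` has even degree, its weight is even and `b` may be
deleted; conversely it is restored with weight zero. In both cases the weight of `a` comes out
odd.
-/

namespace SimpleGraph

variable {V : Type*}

/-! ### Weights on sets of vertices -/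

open Classical in
/-- The total weight of a set `X` of vertices. -/
noncomputable def weightSum [Fintype V] (w : V → ℤ) (X : Set V) : ℤ :=
  ∑ v, X.indicator w v

theorem weightSum_symmDiff_inter [Fintype V] (w : V → ℤ) (X Y Z : Set V) :
    weightSum w ((X ∆ Y) ∩ Z) =
      weightSum w (X ∩ Z) + weightSum w (Y ∩ Z) - 2 * weightSum w (X ∩ Y ∩ Z) := by
  classical
  simp only [weightSum, Finset.mul_sum, ← Finset.sum_add_distrib, ← Finset.sum_sub_distrib]
  refine Finset.sum_congr rfl fun v _ => ?_
  by_cases hX : v ∈ X <;> by_cases hY : v ∈ Y <;> by_cases hZ : v ∈ Z <;>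
    simp [Set.mem_symmDiff, hX, hY, hZ]
  ring

theorem weightSum_insert [Fintype V] (w : V → ℤ) {u : V} {X : Set V} (hu : u ∉ X) :
    weightSum w (insert u X) = w u + weightSum w X := by
  classical
  have h : ∀ v, (insert u X : Set V).indicator w v =
      (if v = u then w u else 0) + X.indicator w v := by
    intro v
    by_cases hv : v = u
    · subst hv; simp [hu]
    · by_cases hX : v ∈ X <;> simp [hv, hX]
  simp [weightSum, h, Finset.sum_add_distrib]

theorem dvd_weightSum_sub [Fintype V] {m : ℤ} {w w' : V → ℤ} {X : Set V}
    (h : ∀ v ∈ X, m ∣ w v - w' v) : m ∣ weightSum w X - weightSum w' X := by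
  classical
  simp only [weightSum, ← Finset.sum_sub_distrib]
  refine Finset.dvd_sum fun v _ => ?_
  by_cases hv : v ∈ X
  · simpa [hv] using h v hv
  · simp [hv]

theorem weightSum_congr [Fintype V] {w w' : V → ℤ} {X : Set V}
    (h : ∀ v ∈ X, w v = w' v) : weightSum w X = weightSum w' X := by
  classical
  simp only [weightSum]
  rw [Set.indicator_congr h]

theorem weightSum_one [Fintype V] (X : Set V) : weightSum (fun _ => 1) X = X.ncard := by
  classical
  rw [Set.ncard_eq_toFinset_card', Finset.card_eq_sum_ones, ← Set.filter_mem_univ_eq_toFinset,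
    Finset.sum_filter]
  simp only [weightSum, Set.indicator_apply, Nat.cast_sum, Nat.cast_ite, Nat.cast_one,
    Nat.cast_zero]

theorem weightSum_one_add_two [Fintype V] (A X : Set V) [DecidablePred (· ∈ A)] :
    weightSum (fun v => if v ∈ A then 3 else 1) X = X.ncard + 2 * (X ∩ A).ncard := by
  rw [← weightSum_one, ← weightSum_one]
  simp only [weightSum, Finset.mul_sum, ← Finset.sum_add_distrib]
  refine Finset.sum_congr rfl fun v _ => ?_
  by_cases hX : v ∈ X <;> by_cases hA : v ∈ A <;> simp [hX, hA]

theorem two_dvd_weightSum_iff [Fintype V] {w : V → ℤ} {X : Set V} (h : ∀ v ∈ X, Odd (w v)) :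
    2 ∣ weightSum w X ↔ Even X.ncard := by
  have h1 : (2 : ℤ) ∣ weightSum w X - weightSum (fun _ => 1) X :=
    dvd_weightSum_sub fun v hv => by
      obtain ⟨k, hk⟩ := h v hv
      exact ⟨k, by rw [hk]; ring⟩
  rw [weightSum_one] at h1
  rw [even_iff_two_dvd]
  omega

/-- Deleting the point `b` removes the weight of `b` from the sets containing it. -/
theorem weightSum_eq_preimage_add [Fintype V] (b : V) [Fintype ({b}ᶜ : Set V)] (w : V → ℤ)
    (X : Set V) :
    weightSum w X = weightSum (fun v : ({b}ᶜ : Set V) => w v) (Subtype.val ⁻¹' X) +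
      X.indicator w b := by
  classical
  have h := Finset.sum_subtype (p := fun v => v ∈ ({b}ᶜ : Set V))
    (F := ‹Fintype ({b}ᶜ : Set V)›) (Finset.univ.erase b)
    (by simp) (X.indicator w)
  simp only [weightSum]
  rw [← Finset.sum_erase_add _ _ (Finset.mem_univ b), h]
  rfl

/-! ### Weights orthogonal to a family of sets -/

/-- The weight is even on all intersections of three members of `R`; members may be repeated. -/
def IsTripleEven [Fintype V] (w : V → ℤ) (R : Set (Set V)) : Prop :=
  ∀ X ∈ R, ∀ Y ∈ R, ∀ Z ∈ R, 2 ∣ weightSum w (X ∩ Y ∩ Z)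

/-- The weight is divisible by 4 on all intersections of two members of `R`, and even on all
intersections of three; members may be repeated. -/
def IsPairDoublyEven [Fintype V] (w : V → ℤ) (R : Set (Set V)) : Prop :=
  (∀ X ∈ R, ∀ Y ∈ R, 4 ∣ weightSum w (X ∩ Y)) ∧ IsTripleEven w R

/-- The sets generated by `R` under symmetric differences: for nonempty `R`, the binary code
spanned by `R`. -/
inductive SymmDiffClosure (R : Set (Set V)) : Set V → Prop
  | mem {X : Set V} : X ∈ R → SymmDiffClosure R X
  | symmDiff {X Y : Set V} : SymmDiffClosure R X → SymmDiffClosure R Y →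
      SymmDiffClosure R (X ∆ Y)

theorem IsTripleEven.closure [Fintype V] {w : V → ℤ} {R : Set (Set V)} (h : IsTripleEven w R) :
    IsTripleEven w {X | SymmDiffClosure R X} := by
  -- evenness on triple intersections is additive in each of the three arguments
  have add : ∀ X Y Z W : Set V, 2 ∣ weightSum w (X ∩ Z ∩ W) → 2 ∣ weightSum w (Y ∩ Z ∩ W) →
      2 ∣ weightSum w (X ∆ Y ∩ Z ∩ W) := by
    intro X Y Z W hX hY
    have := weightSum_symmDiff_inter w X Y (Z ∩ W)
    simp only [← Set.inter_assoc] at this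
    omega
  intro X hX Y hY Z hZ
  induction hX with
  | symmDiff _ _ h₁ h₂ => exact add _ _ _ _ h₁ h₂
  | @mem X hX =>
    rw [Set.inter_comm X]
    induction hY with
    | symmDiff _ _ h₁ h₂ => exact add _ _ _ _ h₁ h₂
    | @mem Y hY =>
      rw [Set.inter_comm, ← Set.inter_assoc]
      induction hZ with
      | symmDiff _ _ h₁ h₂ => exact add _ _ _ _ h₁ h₂
      | @mem Z hZ => exact h Z hZ Y hY X hX

theorem IsPairDoublyEven.closure [Fintype V] {w : V → ℤ} {R : Set (Set V)}
    (h : IsPairDoublyEven w R) : IsPairDoublyEven w {X | SymmDiffClosure R X} := by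
  have h3 := h.2.closure
  refine ⟨fun X hX Y hY => ?_, h3⟩
  have add : ∀ X Y Z : Set V, SymmDiffClosure R X → SymmDiffClosure R Y → SymmDiffClosure R Z →
      4 ∣ weightSum w (X ∩ Z) → 4 ∣ weightSum w (Y ∩ Z) → 4 ∣ weightSum w (X ∆ Y ∩ Z) := by
    intro X Y Z hX hY hZ h₁ h₂
    have h₃ := h3 X hX Y hY Z hZ
    rw [weightSum_symmDiff_inter]
    omega
  induction hX with
  | symmDiff k₁ k₂ h₁ h₂ => exact add _ _ _ k₁ k₂ hY h₁ h₂
  | @mem X hX =>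
    rw [Set.inter_comm]
    induction hY with
    | symmDiff k₁ k₂ h₁ h₂ => exact add _ _ _ k₁ k₂ (.mem hX) h₁ h₂
    | @mem Y hY => exact h.1 Y hY X hX

theorem IsTripleEven.mono [Fintype V] {w : V → ℤ} {R R' : Set (Set V)} (h : IsTripleEven w R)
    (hR : R' ⊆ R) : IsTripleEven w R' :=
  fun X hX Y hY Z hZ => h X (hR hX) Y (hR hY) Z (hR hZ)

theorem IsPairDoublyEven.mono [Fintype V] {w : V → ℤ} {R R' : Set (Set V)}
    (h : IsPairDoublyEven w R) (hR : R' ⊆ R) : IsPairDoublyEven w R' :=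
  ⟨fun X hX Y hY => h.1 X (hR hX) Y (hR hY), h.2.mono hR⟩

theorem IsTripleEven.two_dvd [Fintype V] {w : V → ℤ} {R : Set (Set V)} (h : IsTripleEven w R)
    {X : Set V} (hX : X ∈ R) : 2 ∣ weightSum w X := by
  simpa using h X hX X hX X hX

/-- A point of even weight may be deleted. -/
theorem IsTripleEven.preimage [Fintype V] {b : V} [Fintype ({b}ᶜ : Set V)] {w : V → ℤ}
    {R : Set (Set V)} (h : IsTripleEven w R) (hb : 2 ∣ w b) :
    IsTripleEven (fun v : ({b}ᶜ : Set V) => w v) (Set.preimage Subtype.val '' R) := by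
  rintro _ ⟨X, hX, rfl⟩ _ ⟨Y, hY, rfl⟩ _ ⟨Z, hZ, rfl⟩
  have := h X hX Y hY Z hZ
  rw [weightSum_eq_preimage_add b] at this
  have h2 : 2 ∣ (X ∩ Y ∩ Z).indicator w b := by
    by_cases k : b ∈ X ∩ Y ∩ Z
    · rwa [Set.indicator_of_mem k]
    · simp [Set.indicator_of_notMem k]
  rw [← Set.preimage_inter, ← Set.preimage_inter]
  omega

/-- A deleted point may be restored with weight zero. -/
theorem IsPairDoublyEven.of_preimage [Fintype V] {b : V} [Fintype ({b}ᶜ : Set V)] {w : V → ℤ}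
    {R : Set (Set V)} (hb : w b = 0)
    (h : IsPairDoublyEven (fun v : ({b}ᶜ : Set V) => w v) (Set.preimage Subtype.val '' R)) :
    IsPairDoublyEven w R := by
  have key : ∀ X : Set V, weightSum w X =
      weightSum (fun v : ({b}ᶜ : Set V) => w v) (Subtype.val ⁻¹' X) := by
    intro X
    rw [weightSum_eq_preimage_add b, Set.indicator_apply_eq_zero.2 fun _ => hb, add_zero]
  refine ⟨fun X hX Y hY => ?_, fun X hX Y hY Z hZ => ?_⟩
  · rw [key]
    exact h.1 _ ⟨X, hX, rfl⟩ _ ⟨Y, hY, rfl⟩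
  · rw [key]
    exact h.2 _ ⟨X, hX, rfl⟩ _ ⟨Y, hY, rfl⟩ _ ⟨Z, hZ, rfl⟩

/-! ### Codewords of a bipartite graph -/

theorem IsBipartiteWith.mem_iff_notMem {G : SimpleGraph V} {S : Set V}
    (hG : G.IsBipartiteWith S Sᶜ) {u v : V} (h : G.Adj u v) : u ∈ S ↔ v ∉ S := by
  have := hG.mem_of_adj h
  simp only [Set.mem_compl_iff] at this
  tauto

/-- The closed neighborhoods of the vertices outside `S`. For a graph bipartite with respect to
`S`, `Sᶜ` they are a basis of a binary code on `V`, in systematic form on `Sᶜ`. -/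
def codewords (G : SimpleGraph V) (S : Set V) : Set (Set V) :=
  {X | ∃ u ∉ S, X = insert u (G.neighborSet u)}

theorem codeword_inter {G : SimpleGraph V} {S : Set V} (hG : G.IsBipartiteWith S Sᶜ) {u v : V}
    (hu : u ∉ S) (hv : v ∉ S) (huv : u ≠ v) :
    (insert u (G.neighborSet u) ∩ insert v (G.neighborSet v) : Set V) =
      G.neighborSet u ∩ G.neighborSet v ∩ S := by
  ext x
  simp only [Set.mem_inter_iff, Set.mem_insert_iff, mem_neighborSet]
  have h₁ := hG.mem_iff_notMem (u := u) (v := x)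
  have h₂ := hG.mem_iff_notMem (u := v) (v := x)
  grind

theorem codeword_inter_inter {G : SimpleGraph V} {S : Set V} (hG : G.IsBipartiteWith S Sᶜ)
    {u v x : V} (hu : u ∉ S) (hv : v ∉ S) (hx : x ∉ S) (huv : u ≠ v) :
    (insert u (G.neighborSet u) ∩ insert v (G.neighborSet v) ∩
      insert x (G.neighborSet x) : Set V) =
      G.neighborSet u ∩ G.neighborSet v ∩ G.neighborSet x ∩ S := by
  rw [codeword_inter hG hu hv huv]
  ext y
  simp only [Set.mem_inter_iff, Set.mem_insert_iff]
  have : y = x → y ∉ S := by rintro rfl; exact hx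
  tauto

/-- The weight agreeing with `w` on `S` that vanishes on every codeword. -/
noncomputable def balancedWeight [Fintype V] (G : SimpleGraph V) (S : Set V) (w : V → ℤ) :
    V → ℤ :=
  open Classical in fun v => if v ∈ S then w v else -weightSum w (G.neighborSet v)

theorem balancedWeight_of_mem [Fintype V] (G : SimpleGraph V) {S : Set V} (w : V → ℤ) {v : V}
    (hv : v ∈ S) : balancedWeight G S w v = w v := if_pos hv

theorem weightSum_balancedWeight [Fintype V] {G : SimpleGraph V} {S : Set V}
    (hG : G.IsBipartiteWith S Sᶜ) (w : V → ℤ) {u : V} (hu : u ∉ S) :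
    weightSum (balancedWeight G S w) (insert u (G.neighborSet u)) = 0 := by
  have h : ∀ v ∈ G.neighborSet u, balancedWeight G S w v = w v := fun v hv =>
    balancedWeight_of_mem G w (by have := hG.mem_iff_notMem hv; tauto)
  rw [weightSum_insert _ (by simp), weightSum_congr h, balancedWeight, if_neg hu,
    neg_add_cancel]

/-- For a weight that is odd on `S` and even on each codeword, 2-incidence makes it even on all
triple intersections of codewords. -/
theorem IsTwoIncident.isTripleEven [Fintype V] {G : SimpleGraph V} {S : Set V}
    (h : G.IsTwoIncident S) (hG : G.IsBipartiteWith S Sᶜ) {w : V → ℤ}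
    (hw : ∀ v ∈ S, Odd (w v)) (hd : ∀ X ∈ G.codewords S, 2 ∣ weightSum w X) :
    IsTripleEven w (G.codewords S) := by
  have pair : ∀ X ∈ G.codewords S, ∀ Y ∈ G.codewords S, 2 ∣ weightSum w (X ∩ Y) := by
    rintro _ ⟨u, hu, rfl⟩ _ ⟨v, hv, rfl⟩
    by_cases huv : u = v
    · subst huv
      rw [Set.inter_self]
      exact hd _ ⟨u, hu, rfl⟩
    · rw [codeword_inter hG hu hv huv, two_dvd_weightSum_iff fun x hx => hw x hx.2]
      exact h.even_pair u v hu hv huv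
  rintro X ⟨u, hu, rfl⟩ Y ⟨v, hv, rfl⟩ Z ⟨x, hx, rfl⟩
  by_cases huv : u = v
  · subst huv
    rw [Set.inter_self]
    exact pair _ ⟨u, hu, rfl⟩ _ ⟨x, hx, rfl⟩
  by_cases hux : u = x
  · subst hux
    rw [Set.inter_right_comm, Set.inter_self]
    exact pair _ ⟨u, hu, rfl⟩ _ ⟨v, hv, rfl⟩
  by_cases hvx : v = x
  · subst hvx
    rw [Set.inter_assoc, Set.inter_self]
    exact pair _ ⟨u, hu, rfl⟩ _ ⟨v, hv, rfl⟩
  rw [codeword_inter_inter hG hu hv hx huv, two_dvd_weightSum_iff fun x hx => hw x hx.2]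
  exact h.even_triple u v x hu hv hx huv hux hvx

theorem isTwoIncident_iff_exists_weight [Fintype V] {G : SimpleGraph V} {S : Set V}
    (hG : G.IsBipartiteWith S Sᶜ) :
    G.IsTwoIncident S ↔ ∃ w : V → ℤ, (∀ v ∈ S, Odd (w v)) ∧ IsTripleEven w (G.codewords S) := by
  constructor
  · intro h
    refine ⟨balancedWeight G S fun _ => 1, fun v hv => ?_, ?_⟩
    · rw [balancedWeight_of_mem G _ hv]
      exact odd_one
    · refine h.isTripleEven hG (fun v hv => ?_) ?_
      · rw [balancedWeight_of_mem G _ hv]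
        exact odd_one
      · rintro _ ⟨u, hu, rfl⟩
        rw [weightSum_balancedWeight hG _ hu]
        exact dvd_zero 2
  · rintro ⟨w, hw, h⟩
    refine ⟨fun u hu v hv _ huv => ?_, fun u v hu hv huv => ?_,
      fun u v x hu hv hx huv hux hvx => ?_⟩
    · exact (hG.mem_iff_notMem huv).1 hu hv
    · have := h _ ⟨u, hu, rfl⟩ _ ⟨v, hv, rfl⟩ _ ⟨v, hv, rfl⟩
      rw [Set.inter_assoc, Set.inter_self, codeword_inter hG hu hv huv] at this
      exact (two_dvd_weightSum_iff fun x hx => hw x hx.2).1 this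
    · have := h _ ⟨u, hu, rfl⟩ _ ⟨v, hv, rfl⟩ _ ⟨x, hx, rfl⟩
      rw [codeword_inter_inter hG hu hv hx huv] at this
      exact (two_dvd_weightSum_iff fun x hx => hw x hx.2).1 this

/-! ### Local complementations as weights modulo 4 -/

theorem foldl_localComplement_adj (l : List V) (G : SimpleGraph V)
    (hl : ∀ u ∈ l, ∀ v ∈ l, ¬ G.Adj u v) (x y : V) [DecidablePred fun s => G.Adj x s ∧ G.Adj y s] :
    (l.foldl localComplement G).Adj x y ↔
      Xor (G.Adj x y) (x ≠ y ∧ Odd (l.countP fun s => G.Adj x s ∧ G.Adj y s)) := by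
  classical
  induction l generalizing G with
  | nil => simp [Xor]
  | cons u l ih =>
    have hu : ∀ v ∈ l, ∀ z, (G.localComplement u).Adj z v ↔ G.Adj z v := by
      intro v hv z
      rw [adj_comm, localComplement_adj_of_not_adj G (hl u (by simp) v (by simp [hv])),
        adj_comm]
    rw [List.foldl_cons, ih]
    · have e : (l.countP fun s => (G.localComplement u).Adj x s ∧ (G.localComplement u).Adj y s) =
          l.countP fun s => G.Adj x s ∧ G.Adj y s :=
        List.countP_congr fun v hv => by simp [hu v hv]
      rw [e, List.countP_cons, localComplement_adj, G.adj_comm u x, G.adj_comm u y]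
      by_cases h : G.Adj x u ∧ G.Adj y u
      · simp only [h, Xor, and_self, decide_true, if_true, Nat.odd_add_one]
        tauto
      · simp only [h, Xor, decide_false, Bool.false_eq_true, if_false, add_zero]
        tauto
    · intro v hv z hz
      rw [hu z hz]
      exact hl v (by simp [hv]) z (by simp [hz])

theorem oneLocalComplement_adj {G : SimpleGraph V} {A : Finset V}
    (hA : G.IsIndepSet (A : Set V)) (x y : V) :
    (G.oneLocalComplement A).Adj x y ↔
      Xor (G.Adj x y) (x ≠ y ∧ Odd (G.neighborSet x ∩ G.neighborSet y ∩ A).ncard) := by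
  classical
  have e : (A.toList.countP fun s => G.Adj x s ∧ G.Adj y s) =
      (G.neighborSet x ∩ G.neighborSet y ∩ A).ncard := by
    rw [← Multiset.coe_countP, Finset.coe_toList, Multiset.countP_eq_card_filter,
      ← Finset.filter_val, Finset.card_val, ← Set.ncard_coe_finset]
    congr 1
    ext s
    simp [and_comm]
  rw [oneLocalComplement, foldl_localComplement_adj, e]
  intro u hu v hv huv
  exact hA (by simpa using hu) (by simpa using hv) huv.ne huv

theorem twoLocalComplement_eq_oneLocalComplement_iff {G : SimpleGraph V} {S : Set V}
    (hG : G.IsBipartiteWith S Sᶜ) {A : Finset V} (hA : (A : Set V) ⊆ S) :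
    G.twoLocalComplement S = G.oneLocalComplement A ↔
      ∀ u v : V, u ∉ S → v ∉ S → u ≠ v →
        ((G.neighborSet u ∩ G.neighborSet v ∩ S).ncard % 4 = 2 ↔
          Odd (G.neighborSet u ∩ G.neighborSet v ∩ A).ncard) := by
  have hind : G.IsIndepSet (A : Set V) := fun u hu v hv _ h =>
    (hG.mem_iff_notMem h).1 (hA hu) (hA hv)
  -- a vertex of `S` has no neighbor in `S`
  have h0 : ∀ u v : V, (u ∈ S ∨ v ∈ S) → ∀ B ⊆ S,
      G.neighborSet u ∩ G.neighborSet v ∩ B = ∅ := by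
    intro u v h B hB
    ext x
    simp only [Set.mem_inter_iff, mem_neighborSet, Set.mem_empty_iff_false, iff_false]
    rintro ⟨⟨h₁, h₂⟩, h₃⟩
    have := hG.mem_iff_notMem h₁
    have := hG.mem_iff_notMem h₂
    have := hB h₃
    tauto
  constructor
  · intro h u v hu hv huv
    have := congrArg (fun H : SimpleGraph V => H.Adj u v) h
    simp only [oneLocalComplement_adj hind, twoLocalComplement, Xor, eq_iff_iff] at this
    tauto
  · intro h
    ext u v
    rw [oneLocalComplement_adj hind]
    by_cases huv : u = v
    · subst huv
      simp [Xor]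
    by_cases hm : u ∈ S ∨ v ∈ S
    · simp [twoLocalComplement, h0 u v hm S subset_rfl, h0 u v hm A hA, huv]
    · push Not at hm
      simp only [twoLocalComplement, ← h u v hm.1 hm.2 huv, Xor]
      tauto

/-- A choice of `A ⊆ S` realizing the 2-local complementation is a choice of odd weights modulo 4
on `S`, namely 3 on `A` and 1 elsewhere, for which all common neighborhoods have weight divisible
by 4. -/
theorem IsTwoIncident.not_twoLocalNotOneLocal_iff [Fintype V] {G : SimpleGraph V} {S : Set V}
    (h4 : G.IsTwoIncident S) (hG : G.IsBipartiteWith S Sᶜ) :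
    ¬ G.TwoLocalNotOneLocal S ↔
      ∃ w : V → ℤ, (∀ v ∈ S, Odd (w v)) ∧ IsPairDoublyEven w (G.codewords S) := by
  classical
  have arith : ∀ n k : ℕ, Even n → ((4 : ℤ) ∣ n + 2 * k ↔ (n % 4 = 2 ↔ Odd k)) := by
    intro n k hn
    rw [Nat.even_iff] at hn
    rw [Nat.odd_iff]
    omega
  have hsub : ∀ (A : Finset V), (A : Set V) ⊆ S → ∀ u v : V,
      G.neighborSet u ∩ G.neighborSet v ∩ S ∩ A = G.neighborSet u ∩ G.neighborSet v ∩ A := by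
    intro A hA u v
    rw [Set.inter_assoc _ S, Set.inter_eq_self_of_subset_right hA]
  rw [TwoLocalNotOneLocal, not_not]
  constructor
  · rintro ⟨A, hA, h⟩
    rw [twoLocalComplement_eq_oneLocalComplement_iff hG hA] at h
    set w := balancedWeight G S fun v => if v ∈ (A : Set V) then 3 else 1 with hwdef
    have hw : ∀ v ∈ S, Odd (w v) := by
      intro v hv
      rw [hwdef, balancedWeight_of_mem G _ hv]
      split_ifs <;> decide
    have hd : ∀ X ∈ G.codewords S, weightSum w X = 0 := by
      rintro _ ⟨u, hu, rfl⟩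
      exact weightSum_balancedWeight hG _ hu
    refine ⟨w, hw, ?_, h4.isTripleEven hG hw fun X hX => by simp [hd X hX]⟩
    rintro _ ⟨u, hu, rfl⟩ _ ⟨v, hv, rfl⟩
    by_cases huv : u = v
    · subst huv
      rw [Set.inter_self, hd _ ⟨u, hu, rfl⟩]
      exact dvd_zero 4
    · rw [codeword_inter hG hu hv huv,
        weightSum_congr fun x hx => balancedWeight_of_mem G _ hx.2, weightSum_one_add_two,
        hsub A hA, arith _ _ (h4.even_pair u v hu hv huv)]
      exact h u v hu hv huv
  · rintro ⟨w, hw, h⟩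
    set A : Finset V := Finset.univ.filter fun v => v ∈ S ∧ w v % 4 = 3 with hAdef
    have hA : (A : Set V) ⊆ S := by
      intro v hv
      simp only [hAdef, Finset.coe_filter, Finset.mem_univ, true_and, Set.mem_ofPred_eq] at hv
      exact hv.1
    refine ⟨A, hA, ?_⟩
    rw [twoLocalComplement_eq_oneLocalComplement_iff hG hA]
    intro u v hu hv huv
    rw [← arith _ _ (h4.even_pair u v hu hv huv), ← hsub A hA, ← weightSum_one_add_two]
    have h₁ := h.1 _ ⟨u, hu, rfl⟩ _ ⟨v, hv, rfl⟩
    rw [codeword_inter hG hu hv huv] at h₁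
    have h₂ : (4 : ℤ) ∣ weightSum w (G.neighborSet u ∩ G.neighborSet v ∩ S) -
        weightSum (fun v => if v ∈ (A : Set V) then 3 else 1)
          (G.neighborSet u ∩ G.neighborSet v ∩ S) := by
      refine dvd_weightSum_sub fun x hx => ?_
      have h₃ := hw x hx.2
      rw [Int.odd_iff] at h₃
      have h₄ : x ∈ (A : Set V) ↔ w x % 4 = 3 := by simp [hAdef, hx.2]
      split_ifs with h₅ <;> rw [h₄] at h₅ <;> omega
    omega

/-! ### Pivoting in a bipartite graph -/

theorem pivot_adj_self {G : SimpleGraph V} {a b : V} (hab : G.Adj a b) :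
    (G.pivot a b).Adj a b := by
  simp only [pivot, localComplement_adj, G.irrefl, Xor, hab, hab.symm, ne_eq, hab.ne, hab.ne']
  tauto

theorem IsBipartiteWith.pivot_adj_left {G : SimpleGraph V} {S : Set V}
    (hG : G.IsBipartiteWith S Sᶜ) {a b : V} (hab : G.Adj a b) {y : V} (hya : y ≠ a)
    (hyb : y ≠ b) : (G.pivot a b).Adj a y ↔ G.Adj b y := by
  have k := hG.mem_iff_notMem hab
  have iy := hG.mem_iff_notMem (u := a) (v := y)
  have jy := hG.mem_iff_notMem (u := b) (v := y)
  simp only [pivot, localComplement_adj, G.irrefl, Xor, hab, hab.symm, ne_eq, hab.ne',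
    Ne.symm hya, Ne.symm hyb]
  grind

theorem IsBipartiteWith.pivot_adj_right {G : SimpleGraph V} {S : Set V}
    (hG : G.IsBipartiteWith S Sᶜ) {a b : V} (hab : G.Adj a b) {y : V} (hya : y ≠ a)
    (hyb : y ≠ b) : (G.pivot a b).Adj b y ↔ G.Adj a y := by
  have k := hG.mem_iff_notMem hab
  have iy := hG.mem_iff_notMem (u := a) (v := y)
  have jy := hG.mem_iff_notMem (u := b) (v := y)
  simp only [pivot, localComplement_adj, G.irrefl, Xor, hab, hab.symm, ne_eq, hab.ne, hab.ne',
    Ne.symm hya, Ne.symm hyb]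
  grind

theorem IsBipartiteWith.pivot_adj_of_ne {G : SimpleGraph V} {S : Set V}
    (hG : G.IsBipartiteWith S Sᶜ) {a b : V} (hab : G.Adj a b) {x y : V}
    (hxa : x ≠ a) (hxb : x ≠ b) (hya : y ≠ a) (hyb : y ≠ b) :
    (G.pivot a b).Adj x y ↔
      Xor (G.Adj x y) ((G.Adj a x ∧ G.Adj b y) ∨ (G.Adj b x ∧ G.Adj a y)) := by
  have k := hG.mem_iff_notMem hab
  have ix := hG.mem_iff_notMem (u := a) (v := x)
  have iy := hG.mem_iff_notMem (u := a) (v := y)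
  have jx := hG.mem_iff_notMem (u := b) (v := x)
  have jy := hG.mem_iff_notMem (u := b) (v := y)
  have l : x = y → ¬ G.Adj x y := by rintro rfl; exact G.irrefl
  simp only [pivot, localComplement_adj, G.irrefl, Xor, hab, hab.symm, ne_eq, hab.ne',
    Ne.symm hxa, Ne.symm hxb, Ne.symm hya, Ne.symm hyb]
  grind

theorem mem_symmDiff_pair_iff {S : Set V} {a b : V} (ha : a ∈ S) (hb : b ∉ S) (x : V) :
    x ∈ S ∆ {a, b} ↔ (x ∈ S ∧ x ≠ a) ∨ x = b := by
  simp only [Set.mem_symmDiff, Set.mem_insert_iff, Set.mem_singleton_iff]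
  grind

theorem IsBipartiteWith.pivot {G : SimpleGraph V} {S : Set V} (hG : G.IsBipartiteWith S Sᶜ)
    {a b : V} (ha : a ∈ S) (hb : b ∉ S) (hab : G.Adj a b) :
    (G.pivot a b).IsBipartiteWith (S ∆ {a, b}) (S ∆ {a, b})ᶜ := by
  refine ⟨disjoint_compl_right, fun x y h => ?_⟩
  suffices x ∈ S ∆ {a, b} ↔ y ∉ S ∆ {a, b} by
    simp only [Set.mem_compl_iff]
    grind
  rw [mem_symmDiff_pair_iff ha hb, mem_symmDiff_pair_iff ha hb]
  have hne : a ≠ b := hab.ne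
  have hirr := h.ne
  -- one end of the edge is `a` or `b`
  have main : ∀ x y, (x = a ∨ x = b) → x ≠ y → (G.pivot a b).Adj x y →
      ((x ∈ S ∧ x ≠ a ∨ x = b) ↔ ¬ (y ∈ S ∧ y ≠ a ∨ y = b)) := by
    rintro x y (rfl | rfl) hxy h
    · by_cases hyb : y = b
      · grind
      · rw [hG.pivot_adj_left hab hxy.symm hyb] at h
        have := hG.mem_iff_notMem h
        grind
    · by_cases hya : y = a
      · grind
      · rw [hG.pivot_adj_right hab hya hxy.symm] at h
        have := hG.mem_iff_notMem h
        grind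
  by_cases hx : x = a ∨ x = b
  · exact main x y hx hirr h
  by_cases hy : y = a ∨ y = b
  · have := main y x hy hirr.symm h.symm
    tauto
  push Not at hx hy
  rw [hG.pivot_adj_of_ne hab hx.1 hx.2 hy.1 hy.2] at h
  have k := hG.mem_iff_notMem (u := x) (v := y)
  have ix := hG.mem_iff_notMem (u := a) (v := x)
  have iy := hG.mem_iff_notMem (u := a) (v := y)
  have jx := hG.mem_iff_notMem (u := b) (v := x)
  have jy := hG.mem_iff_notMem (u := b) (v := y)
  simp only [Xor] at h
  grind

/-- Pivoting exchanges the roles of `a` and `b`: the codeword of `b` becomes that of `a`. -/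
theorem IsBipartiteWith.pivot_codeword_left {G : SimpleGraph V} {S : Set V}
    (hG : G.IsBipartiteWith S Sᶜ) {a b : V} (hab : G.Adj a b) :
    insert a ((G.pivot a b).neighborSet a) = insert b (G.neighborSet b) := by
  ext y
  simp only [Set.mem_insert_iff, mem_neighborSet]
  by_cases hya : y = a
  · simp [hya, hab.symm]
  by_cases hyb : y = b
  · simp [hyb, pivot_adj_self hab]
  simp [hya, hyb, hG.pivot_adj_left hab hya hyb]

theorem IsBipartiteWith.pivot_codeword_of_not_adj {G : SimpleGraph V} {S : Set V}
    (hG : G.IsBipartiteWith S Sᶜ) {a b : V} (ha : a ∈ S) (hb : b ∉ S) (hab : G.Adj a b) {u : V}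
    (hu : u ∉ S) (hub : u ≠ b) (hau : ¬ G.Adj a u) :
    insert u ((G.pivot a b).neighborSet u) = insert u (G.neighborSet u) := by
  have hua : u ≠ a := by rintro rfl; exact hu ha
  have hbu : ¬ G.Adj b u := fun h => hb ((hG.mem_iff_notMem h).2 hu)
  ext y
  simp only [Set.mem_insert_iff, mem_neighborSet]
  by_cases hya : y = a
  · subst hya
    simp [adj_comm _ u, hG.pivot_adj_left hab hua hub, hau, hbu]
  by_cases hyb : y = b
  · subst hyb
    simp [adj_comm _ u, hG.pivot_adj_right hab hua hub, hau, hbu]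
  simp [hG.pivot_adj_of_ne hab hua hub hya hyb, hau, hbu, Xor]

theorem IsBipartiteWith.pivot_codeword_of_adj {G : SimpleGraph V} {S : Set V}
    (hG : G.IsBipartiteWith S Sᶜ) {a b : V} (ha : a ∈ S) (hb : b ∉ S) (hab : G.Adj a b) {u : V}
    (hu : u ∉ S) (hub : u ≠ b) (hau : G.Adj a u) :
    insert u ((G.pivot a b).neighborSet u) =
      insert u (G.neighborSet u) ∆ insert b (G.neighborSet b) := by
  have hua : u ≠ a := by rintro rfl; exact hu ha
  have hbu : ¬ G.Adj b u := fun h => hb ((hG.mem_iff_notMem h).2 hu)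
  ext y
  simp only [Set.mem_symmDiff, Set.mem_insert_iff, mem_neighborSet]
  by_cases hya : y = a
  · subst hya
    simp [adj_comm _ u, hG.pivot_adj_left hab hua hub, hau, hbu, hab.symm, hua.symm]
  by_cases hyb : y = b
  · subst hyb
    simp [adj_comm _ u, hG.pivot_adj_right hab hua hub, hau, hbu, hub.symm]
  by_cases hyu : y = u
  · subst hyu
    simp [hbu, hub]
  simp [hG.pivot_adj_of_ne hab hua hub hya hyb, hau, hbu, Xor, hyu, hyb]

/-- Pivoting on `ab` preserves the code: the new codewords are generated by the old ones. -/
theorem IsBipartiteWith.pivot_codewords_subset {G : SimpleGraph V} {S : Set V}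
    (hG : G.IsBipartiteWith S Sᶜ) {a b : V} (ha : a ∈ S) (hb : b ∉ S) (hab : G.Adj a b) :
    (G.pivot a b).codewords (S ∆ {a, b}) ⊆ {X | SymmDiffClosure (G.codewords S) X} := by
  rintro _ ⟨u, hu, rfl⟩
  rw [mem_symmDiff_pair_iff ha hb] at hu
  change SymmDiffClosure _ _
  by_cases hua : u = a
  · subst hua
    rw [hG.pivot_codeword_left hab]
    exact .mem ⟨b, hb, rfl⟩
  have huS : u ∉ S := by tauto
  have hub : u ≠ b := by tauto
  by_cases hau : G.Adj a u
  · rw [hG.pivot_codeword_of_adj ha hb hab huS hub hau]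
    exact .symmDiff (.mem ⟨u, huS, rfl⟩) (.mem ⟨b, hb, rfl⟩)
  · rw [hG.pivot_codeword_of_not_adj ha hb hab huS hub hau]
    exact .mem ⟨u, huS, rfl⟩

/-- Pivoting on `ab` preserves the code: the old codewords are generated by the new ones. -/
theorem IsBipartiteWith.codewords_subset_pivot {G : SimpleGraph V} {S : Set V}
    (hG : G.IsBipartiteWith S Sᶜ) {a b : V} (ha : a ∈ S) (hb : b ∉ S) (hab : G.Adj a b) :
    G.codewords S ⊆ {X | SymmDiffClosure ((G.pivot a b).codewords (S ∆ {a, b})) X} := by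
  have haS : a ∉ S ∆ {a, b} := by
    rw [mem_symmDiff_pair_iff ha hb]
    have := hab.ne
    tauto
  rintro _ ⟨u, hu, rfl⟩
  change SymmDiffClosure _ _
  by_cases hub : u = b
  · subst hub
    rw [← hG.pivot_codeword_left hab]
    exact .mem ⟨a, haS, rfl⟩
  have huS : u ∉ S ∆ {a, b} := by
    rw [mem_symmDiff_pair_iff ha hb]
    tauto
  by_cases hau : G.Adj a u
  · rw [← symmDiff_symmDiff_cancel_right (insert b (G.neighborSet b)) (insert u _),
      ← hG.pivot_codeword_of_adj ha hb hab hu hub hau, ← hG.pivot_codeword_left hab]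
    exact .symmDiff (.mem ⟨u, huS, rfl⟩) (.mem ⟨a, haS, rfl⟩)
  · rw [← hG.pivot_codeword_of_not_adj ha hb hab hu hub hau]
    exact .mem ⟨u, huS, rfl⟩

/-! ### Deleting a vertex -/

theorem IsBipartiteWith.induce_compl {G : SimpleGraph V} {S : Set V}
    (hG : G.IsBipartiteWith S Sᶜ) (U : Set V) :
    (G.induce U).IsBipartiteWith (Subtype.val ⁻¹' S) (Subtype.val ⁻¹' S)ᶜ :=
  ⟨disjoint_compl_right, fun _ _ h => hG.mem_of_adj h⟩

theorem codewords_induce_compl_singleton {G : SimpleGraph V} {S : Set V} {b : V} (hb : b ∈ S) :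
    (G.induce {b}ᶜ).codewords (Subtype.val ⁻¹' S) = Set.preimage Subtype.val '' G.codewords S := by
  have e : ∀ u : ({b}ᶜ : Set V), insert u ((G.induce {b}ᶜ).neighborSet u) =
      Subtype.val ⁻¹' insert (u : V) (G.neighborSet u) := by
    intro u
    ext x
    simp [Subtype.ext_iff]
  ext X
  constructor
  · rintro ⟨u, hu, rfl⟩
    exact ⟨_, ⟨u, hu, rfl⟩, (e u).symm⟩
  · rintro ⟨_, ⟨u, hu, rfl⟩, rfl⟩
    have hub : u ∈ ({b}ᶜ : Set V) := by rintro rfl; exact hu hb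
    exact ⟨⟨u, hub⟩, hu, (e ⟨u, hub⟩).symm⟩

/-! ### Pivoting preserves both properties -/

/-- In a codeword of even weight, the weights that are known to be odd determine the parity of the
remaining one. -/
theorem odd_of_two_dvd_weightSum_insert [Fintype V] {w : V → ℤ} {u : V} {X : Set V}
    (hu : u ∉ X) (hw : ∀ v ∈ X, Odd (w v)) (h : 2 ∣ weightSum w (insert u X)) :
    Odd (w u) ↔ Odd X.ncard := by
  have h1 := two_dvd_weightSum_iff hw
  rw [weightSum_insert _ hu] at h
  rw [Nat.even_iff] at h1
  rw [Nat.odd_iff, Int.odd_iff]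
  omega

end SimpleGraph

open SimpleGraph in
theorem mainTheorem4 {V : Type*} [Fintype V] (G : SimpleGraph V) [DecidableRel G.Adj]
    (S : Set V) (hbip : G.IsBipartiteWith S Sᶜ)
    (h4 : G.IsTwoIncident S) (h5 : G.TwoLocalNotOneLocal S)
    (a b : V) (ha : a ∈ S) (hb : b ∉ S) (hab : G.Adj a b) :
    (Odd (G.degree b) →
      ∀ S' : Set V, S' = S ∆ {a, b} →
        (G.pivot a b).IsBipartiteWith S' S'ᶜ ∧
        (G.pivot a b).IsTwoIncident S' ∧
        (G.pivot a b).TwoLocalNotOneLocal S') ∧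
    (Even (G.degree b) →
      ∀ S' : Set ({b}ᶜ : Set V), S' = Subtype.val ⁻¹' (S \ {a}) →
        ((G.pivot a b).induce {b}ᶜ).IsBipartiteWith S' S'ᶜ ∧
        ((G.pivot a b).induce {b}ᶜ).IsTwoIncident S' ∧
        ((G.pivot a b).induce {b}ᶜ).TwoLocalNotOneLocal S') := by
  classical
  have hbip' := hbip.pivot ha hb hab
  have hdeg : (G.neighborSet b).ncard = G.degree b := by
    rw [Set.ncard_eq_toFinset_card', Set.toFinset_card, card_neighborSet_eq_degree]
  have hNb : ∀ v ∈ G.neighborSet b, v ∈ S := fun v hv => by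
    have := hbip.mem_iff_notMem hv
    tauto
  obtain ⟨w, hw, hwG⟩ := (isTwoIncident_iff_exists_weight hbip).1 h4
  have hwG' : IsTripleEven w ((G.pivot a b).codewords (S ∆ {a, b})) :=
    hwG.closure.mono (hbip.pivot_codewords_subset ha hb hab)
  have hwb : Odd (w b) ↔ Odd (G.degree b) := by
    rw [← hdeg]
    exact odd_of_two_dvd_weightSum_insert (by simp) (fun v hv => hw v (hNb v hv))
      (hwG.two_dvd ⟨b, hb, rfl⟩)
  -- a weight satisfying the conditions for the new graph satisfies them for the old one
  have back : ∀ w' : V → ℤ, IsPairDoublyEven w' ((G.pivot a b).codewords (S ∆ {a, b})) →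
      (∀ v ∈ S, v ≠ a → Odd (w' v)) → Odd (w' a) → False := by
    intro w' h hodd ha'
    refine (h4.not_twoLocalNotOneLocal_iff hbip).2 ⟨w', fun v hv => ?_,
      h.closure.mono (hbip.codewords_subset_pivot ha hb hab)⟩ h5
    by_cases hva : v = a
    · rwa [hva]
    · exact hodd v hv hva
  have hmem := mem_symmDiff_pair_iff ha hb
  have hbS : b ∈ S ∆ {a, b} := (hmem b).2 (.inr rfl)
  have haS : a ∉ S ∆ {a, b} := by
    rw [hmem]
    have := hab.ne
    tauto
  have hcard : (G.neighborSet b \ {a}).ncard + 1 = G.degree b := by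
    rw [← hdeg]
    exact Set.ncard_sdiff_singleton_add_one hab.symm
  refine ⟨fun hodd S' hS' => ?_, fun heven S' hS' => ?_⟩
  · subst hS'
    have h4' : (G.pivot a b).IsTwoIncident (S ∆ {a, b}) := by
      refine (isTwoIncident_iff_exists_weight hbip').2 ⟨w, fun v hv => ?_, hwG'⟩
      rcases (hmem v).1 hv with h | rfl
      · exact hw v h.1
      · exact hwb.2 hodd
    refine ⟨hbip', h4', not_not.1 fun h5' => ?_⟩
    obtain ⟨w', hw', hwG''⟩ := (h4'.not_twoLocalNotOneLocal_iff hbip').1 h5'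
    refine back w' hwG'' (fun v hv hva => hw' v ((hmem v).2 (.inl ⟨hv, hva⟩))) ?_
    -- the new neighborhood of `a` has as many elements as the old one of `b`
    have hd := hwG''.2.two_dvd ⟨a, haS, rfl⟩
    refine (odd_of_two_dvd_weightSum_insert (by simp) (fun v hv => hw' v ?_) hd).2 ?_
    · exact not_not.1 fun h => haS ((hbip'.mem_iff_notMem hv).2 h)
    · have e : (G.pivot a b).neighborSet a = insert b (G.neighborSet b \ {a}) := by
        have h := congrArg (· \ {a}) (hbip.pivot_codeword_left hab)
        simp only [Set.insert_sdiff_of_mem _ (Set.mem_singleton a)] at h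
        rw [Set.sdiff_singleton_eq_self (by simp)] at h
        rw [h, Set.insert_sdiff_of_notMem _ (by simpa using hab.ne')]
      rw [e, Set.ncard_insert_of_notMem (by simp), hcard]
      exact hodd
  · have hS : S' = Subtype.val ⁻¹' (S ∆ {a, b}) := by
      rw [hS']
      ext ⟨v, hv⟩
      have hvb : v ≠ b := hv
      simp only [Set.mem_preimage, hmem, Set.mem_sdiff, Set.mem_singleton_iff]
      tauto
    clear hS'
    subst hS
    have hbipI := hbip'.induce_compl {b}ᶜ
    have hcw := codewords_induce_compl_singleton (G := G.pivot a b) hbS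
    have h4' : ((G.pivot a b).induce {b}ᶜ).IsTwoIncident (Subtype.val ⁻¹' (S ∆ {a, b})) := by
      refine (isTwoIncident_iff_exists_weight hbipI).2 ⟨fun v => w v, fun v hv => ?_, ?_⟩
      · rcases (hmem v).1 hv with h | h
        · exact hw v h.1
        · exact absurd h v.2
      · rw [hcw]
        refine hwG'.preimage ?_
        rw [← even_iff_two_dvd, ← Int.not_odd_iff_even, hwb, Nat.not_odd_iff_even]
        exact heven
    refine ⟨hbipI, h4', not_not.1 fun h5' => ?_⟩
    obtain ⟨w₀, hw₀, hwI⟩ := (h4'.not_twoLocalNotOneLocal_iff hbipI).1 h5'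
    -- the vertex `b` is restored with weight zero
    set w' : V → ℤ := fun v => if h : v ∈ ({b}ᶜ : Set V) then w₀ ⟨v, h⟩ else 0 with hw'def
    have hval : (fun v : ({b}ᶜ : Set V) => w' v) = w₀ := by
      funext v
      exact dif_pos v.2
    have hw'b : w' b = 0 := dif_neg (by simp)
    rw [hcw, ← hval] at hwI
    have hwG'' := hwI.of_preimage hw'b
    have hodd' : ∀ v ∈ S, v ≠ a → Odd (w' v) := by
      intro v hv hva
      have hvb : v ∈ ({b}ᶜ : Set V) := by rintro rfl; exact hb hv
      rw [hw'def]
      simp only [hvb, dite_true]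
      exact hw₀ ⟨v, hvb⟩ ((hmem v).2 (.inl ⟨hv, hva⟩))
    refine back w' hwG'' hodd' ?_
    -- the codeword of `a` is `a`, `b` and the other neighbors of `b`, where `b` has weight zero
    have hd := hwG''.2.two_dvd ⟨a, haS, rfl⟩
    rw [hbip.pivot_codeword_left hab, weightSum_insert _ (by simp), hw'b, zero_add,
      ← Set.insert_sdiff_self_of_mem (s := G.neighborSet b) hab.symm] at hd
    refine (odd_of_two_dvd_weightSum_insert (by simp) (fun v hv => ?_) hd).2 ?_
    · exact hodd' v (hNb v hv.1) hv.2
    · rw [Nat.odd_iff]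
      rw [Nat.even_iff] at heven
      omega
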